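/- Let $d>2$ be an integer. There are constants $C>0$ and $R_0>0$, depending only on $d$, such that the following holds. Let $n\ge 0$ be an integer and $Q_n=\{a\in\mathbb Z^d:\|a\|_\infty\le n\}$, let $\overline V:Q_n\to[0,1]$ be any function, and let $R\ge R_0$ be a real number such that for every $a\in Q_n$ there is $b\in Q_n$ with $\overline V(b)=1$ and $|a-b|<R$, where $|\cdot|$ is the Euclidean norm. Let $\overline H=-\Delta+\overline V:\ell^2(Q_n)\to\ell^2(Q_n)$ with Dirichlet boundary condition, that is, $$\overline Hu(a)=2d\,u(a)-\sum_{b\in Q_n,\ |a-b|=1}u(b)+\overline V(a)u(a)\qquad(a\in Q_n).$$ Then the principal (smallest) eigenvalue of $\overline H$ is at least $C R^{-d}$. -/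

import Mathlib

noncomputable section

namespace LatticeSchrodinger

/-- The Euclidean norm `|a|` of a lattice point `a ∈ ℤ^d`. -/
def euclNorm {d : ℕ} (a : Fin d → ℤ) : ℝ := √(∑ i, (a i : ℝ) ^ 2)

/-- The cube `Q_n = {a ∈ ℤ^d : ‖a‖_∞ ≤ n}`. -/
def cube (d n : ℕ) : Finset (Fin d → ℤ) := Finset.Icc (fun _ => -(n : ℤ)) (fun _ => (n : ℤ))

theorem mem_cube {d n : ℕ} {a : Fin d → ℤ} : a ∈ cube d n ↔ ∀ i, |a i| ≤ (n : ℤ) := by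
  simp only [cube, Finset.mem_Icc, Pi.le_def, abs_le, forall_and]

/-- The standard basis vector `e_i` of `ℤ^d`. -/
def stdVec {d : ℕ} (i : Fin d) : Fin d → ℤ := Pi.single i 1

/-- The discrete Laplacian `Δ u(a) = - 2 d u(a) + ∑_{|b - a| = 1} u(b)` on functions on `ℤ^d`;
the points at Euclidean distance one from `a` are the points `a + e_i` and `a - e_i`. -/
def laplacian {d : ℕ} (u : (Fin d → ℤ) → ℝ) (a : Fin d → ℤ) : ℝ :=
  -(2 * (d : ℝ)) * u a + ∑ i, (u (a + stdVec i) + u (a - stdVec i))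

/-- The Hilbert space `ℓ²(Q_n)`. -/
abbrev CubeL2 (d n : ℕ) : Type := EuclideanSpace ℝ (cube d n)

/-- Extension by zero of a function on `Q_n` to the whole lattice `ℤ^d`. -/
def extendZero {d n : ℕ} (u : CubeL2 d n) (a : Fin d → ℤ) : ℝ :=
  if h : a ∈ cube d n then u ⟨a, h⟩ else 0

theorem extendZero_add {d n : ℕ} (u v : CubeL2 d n) (a : Fin d → ℤ) :
    extendZero (u + v) a = extendZero u a + extendZero v a := by
  unfold extendZero; split_ifs <;> simp

theorem extendZero_smul {d n : ℕ} (c : ℝ) (u : CubeL2 d n) (a : Fin d → ℤ) :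
    extendZero (c • u) a = c * extendZero u a := by
  unfold extendZero; split_ifs <;> simp

/-- The operator `-Δ + V` on `ℓ²(Q_n)` with Dirichlet boundary condition: extend by zero outside
`Q_n`, apply `-Δ`, restrict to `Q_n`, and add multiplication by `V`. -/
def dirichletOp {d n : ℕ} (V : cube d n → ℝ) : CubeL2 d n →ₗ[ℝ] CubeL2 d n where
  toFun u := WithLp.toLp 2 fun a => -laplacian (extendZero u) a + V a * u a
  map_add' u v := by
    ext a
    simp only [laplacian, extendZero_add, PiLp.add_apply, Finset.sum_add_distrib]
    ring
  map_smul' c u := by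
    ext a
    simp only [laplacian, extendZero_smul, PiLp.smul_apply, Finset.sum_add_distrib,
      ← Finset.mul_sum, smul_eq_mul, RingHom.id_apply]
    ring

/-- The principal eigenvalue, i.e. the smallest eigenvalue, of the operator `-Δ + V` on `ℓ²(Q_n)`
with Dirichlet boundary condition. -/
def principalEigenvalue {d n : ℕ} (V : cube d n → ℝ) : ℝ :=
  sInf {μ : ℝ | Module.End.HasEigenvalue (dirichletOp V) μ}

theorem extendZero_eq_sum {d n : ℕ} (u : CubeL2 d n) (a : Fin d → ℤ) :
    extendZero u a = ∑ b : cube d n, if (b : Fin d → ℤ) = a then u b else 0 := by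
  unfold extendZero
  split_ifs with h
  · rw [Finset.sum_eq_single ⟨a, h⟩]
    · simp
    · intro b _ hb
      rw [if_neg fun hba => hb (Subtype.ext hba)]
    · simp
  · refine (Finset.sum_eq_zero fun b _ => if_neg ?_).symm
    rintro rfl
    exact h b.2

theorem sum_extendZero_shift {d n : ℕ} (u v : CubeL2 d n) (e : Fin d → ℤ) :
    ∑ a : cube d n, v a * extendZero u (a + e) = ∑ a : cube d n, u a * extendZero v (a - e) := by
  simp only [extendZero_eq_sum, Finset.mul_sum]
  rw [Finset.sum_comm]
  refine Finset.sum_congr rfl fun b _ => Finset.sum_congr rfl fun a _ => ?_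
  by_cases h : (b : Fin d → ℤ) = a + e
  · have h' : (a : Fin d → ℤ) = b - e := by rw [h]; simp
    rw [if_pos h, if_pos h', mul_comm]
  · have h' : ¬ (a : Fin d → ℤ) = b - e := fun h' => h (by rw [h']; simp)
    rw [if_neg h, if_neg h', mul_zero, mul_zero]

theorem dirichletOp_isSymmetric {d n : ℕ} (V : cube d n → ℝ) : (dirichletOp V).IsSymmetric := by
  have key : ∀ u v : CubeL2 d n, ∑ a : cube d n, v a * dirichletOp V u a
      = (∑ a : cube d n, (2 * (d : ℝ) + V a) * (u a * v a))
        - ∑ i : Fin d, ((∑ a : cube d n, v a * extendZero u (a + stdVec i))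
          + ∑ a : cube d n, v a * extendZero u (a - stdVec i)) := by
    intro u v
    simp only [← Finset.sum_add_distrib]
    rw [Finset.sum_comm, ← Finset.sum_sub_distrib]
    refine Finset.sum_congr rfl fun a _ => ?_
    have hu : extendZero u a = u a := by simp [extendZero]
    simp only [dirichletOp, laplacian, LinearMap.coe_mk, AddHom.coe_mk, hu, ← mul_add,
      ← Finset.mul_sum]
    ring
  intro u v
  have h1 : inner ℝ (dirichletOp V u) v = ∑ a : cube d n, v a * dirichletOp V u a := by
    simp [PiLp.inner_apply]
  have h2 : inner ℝ u (dirichletOp V v) = ∑ a : cube d n, u a * dirichletOp V v a := by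
    simp [PiLp.inner_apply, mul_comm]
  rw [h1, h2, key, key]
  congr 1
  · exact Finset.sum_congr rfl fun a _ => by ring
  · refine Finset.sum_congr rfl fun i _ => ?_
    rw [sum_extendZero_shift u v, ← sum_extendZero_shift v u, add_comm]

/-- The infimum defining the principal eigenvalue is attained: it is the smallest eigenvalue. -/
theorem principalEigenvalue_isLeast {d n : ℕ} (V : cube d n → ℝ) :
    IsLeast {μ : ℝ | Module.End.HasEigenvalue (dirichletOp V) μ} (principalEigenvalue V) := by
  have hfin : {μ : ℝ | Module.End.HasEigenvalue (dirichletOp V) μ}.Finite :=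
    Module.End.finite_hasEigenvalue (dirichletOp V)
  have h0 : (0 : Fin d → ℤ) ∈ cube d n := by simp [mem_cube]
  have : Nonempty (cube d n) := ⟨⟨0, h0⟩⟩
  have hne : {μ : ℝ | Module.End.HasEigenvalue (dirichletOp V) μ}.Nonempty :=
    ⟨_, (dirichletOp_isSymmetric V).hasEigenvalue_iInf_of_finiteDimensional⟩
  exact ⟨hne.csInf_mem hfin, fun μ hμ => csInf_le hfin.bddBelow hμ⟩

end LatticeSchrodinger

end

/-! In dimension at least three a single lattice point has positive capacity uniformly in scale: two
values of `u` at distance at most `L` differ in square by at most a constant, independent of `L`,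
times the energy in a box of side of order `L` (`sq_sub_le_energy`). To see this, compare `u a` with
the values of `u` on boxes of side `4 ^ k` cornered at `a`. Passing from one scale to the next adds
at most a multiple of `2 ^ (-k) √E` to the root mean square deviation, because a translation costs
`(4 ^ k) ^ 2 E` while the box has at least `(4 ^ k) ^ 3` points; the increments form a convergent
geometric series.

Taking for `b` a nearby site with `V b = 1`, the value `u b ^ 2` is itself a term of the potential
energy, so `u a ^ 2` is bounded by the quadratic form density in a box of side of order `R`
(`sq_extendZero_le_local_sum`). Summing over `a` counts each site of order `R ^ d` times, which
gives the Poincaré inequality `sum_sq_le_quadraticForm`; an eigenvector for the principal eigenvalue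
then yields the bound. -/

namespace LatticeSchrodinger

variable {d : ℕ}

/-! ### Energy and translation estimates -/

/-- The energy density `∑ᵢ (u(x + eᵢ) - u(x))²` of a function on the lattice. -/
def energyDensity (u : (Fin d → ℤ) → ℝ) (x : Fin d → ℤ) : ℝ :=
  ∑ i, (u (x + stdVec i) - u x) ^ 2

theorem energyDensity_nonneg (u : (Fin d → ℤ) → ℝ) (x : Fin d → ℤ) : 0 ≤ energyDensity u x :=
  Finset.sum_nonneg fun _ _ => sq_nonneg _

/-- Telescoping along the segment and Cauchy–Schwarz; each squared increment is one term of the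
energy density. -/
theorem sq_sub_add_nsmul_stdVec_le (u : (Fin d → ℤ) → ℝ) (x : Fin d → ℤ) (i : Fin d) (M : ℕ) :
    (u (x + M • stdVec i) - u x) ^ 2 ≤
      M * ∑ j ∈ Finset.range M, energyDensity u (x + j • stdVec i) := by
  have h1 : u (x + M • stdVec i) - u x =
      ∑ j ∈ Finset.range M, (u (x + (j + 1) • stdVec i) - u (x + j • stdVec i)) := by
    rw [Finset.sum_range_sub (fun j => u (x + j • stdVec i))]
    simp
  rw [h1]
  refine sq_sum_le_card_mul_sum_sq.trans ?_
  rw [Finset.card_range]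
  gcongr with j hj
  have h2 : x + (j + 1) • stdVec i = x + j • stdVec i + stdVec i := by
    rw [succ_nsmul, add_assoc]
  rw [h2]
  exact Finset.single_le_sum (f := fun k => (u (x + j • stdVec i + stdVec k)
    - u (x + j • stdVec i)) ^ 2) (fun _ _ => sq_nonneg _) (Finset.mem_univ i)

/-- For fixed `j` the shift of `S` is injective into `W`, so each of the `M` shifts costs at most
the whole energy of `W`; the other factor `M` is from Cauchy–Schwarz. -/
theorem sum_sq_sub_add_nsmul_stdVec_le (u : (Fin d → ℤ) → ℝ) (S W : Finset (Fin d → ℤ))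
    (z : Fin d → ℤ) (i : Fin d) (M : ℕ)
    (hW : ∀ x ∈ S, ∀ j < M, x + z + j • stdVec i ∈ W) :
    ∑ x ∈ S, (u (x + z + M • stdVec i) - u (x + z)) ^ 2 ≤
      (M : ℝ) ^ 2 * ∑ y ∈ W, energyDensity u y := by
  calc ∑ x ∈ S, (u (x + z + M • stdVec i) - u (x + z)) ^ 2
      ≤ ∑ x ∈ S, M * ∑ j ∈ Finset.range M, energyDensity u (x + z + j • stdVec i) :=
        Finset.sum_le_sum fun x _ => sq_sub_add_nsmul_stdVec_le u (x + z) i M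
    _ = M * ∑ j ∈ Finset.range M, ∑ x ∈ S, energyDensity u (x + z + j • stdVec i) := by
        rw [← Finset.mul_sum, Finset.sum_comm]
    _ ≤ M * ∑ j ∈ Finset.range M, ∑ y ∈ W, energyDensity u y := by
        gcongr with j hj
        have hinj : Set.InjOn (fun x => x + z + j • stdVec i) (S : Set (Fin d → ℤ)) := by
          intro x _ y _ h
          simpa using h
        rw [← Finset.sum_image (f := energyDensity u) hinj]
        refine Finset.sum_le_sum_of_subset_of_nonneg ?_ fun y _ _ => energyDensity_nonneg u y
        intro y hy
        obtain ⟨x, hx, rfl⟩ := Finset.mem_image.1 hy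
        exact hW x hx j (Finset.mem_range.1 hj)
    _ = _ := by
        rw [Finset.sum_const, Finset.card_range, nsmul_eq_mul]
        ring

/-- Translating by `v` with `0 ≤ v ≤ M` changes `u` on `S` in square mean by at most the energy on
any set that contains the boxes spanned by the points of `S` and their translates. -/
theorem sum_sq_sub_translate_le (u : (Fin d → ℤ) → ℝ) (S W : Finset (Fin d → ℤ))
    (v : Fin d → ℕ) (M : ℕ) (hM : ∀ i, v i ≤ M)
    (hW : ∀ x ∈ S, ∀ w : Fin d → ℤ, 0 ≤ w → (∀ i, w i ≤ v i) → x + w ∈ W) :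
    ∑ x ∈ S, (u (x + fun i => (v i : ℤ)) - u x) ^ 2 ≤
      4 ^ d * (M : ℝ) ^ 2 * ∑ y ∈ W, energyDensity u y := by
  have hE : 0 ≤ ∑ y ∈ W, energyDensity u y := Finset.sum_nonneg fun y _ => energyDensity_nonneg u y
  -- Coordinates are moved one at a time. With `(p + q)² ≤ 2p² + 2q²` the constant `c` becomes `2c +
  -- 2`, and `4 ^ s.card - 1` absorbs this while vanishing at `s = ∅`.
  have key : ∀ s : Finset (Fin d),
      ∑ x ∈ S, (u (x + fun i => if i ∈ s then (v i : ℤ) else 0) - u x) ^ 2 ≤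
        (4 ^ s.card - 1) * ((M : ℝ) ^ 2 * ∑ y ∈ W, energyDensity u y) := by
    intro s
    induction s using Finset.induction_on with
    | empty =>
      have : ∀ x : Fin d → ℤ, (x + fun _ => (0 : ℤ)) = x := fun x => add_zero x
      simp [this]
    | insert i s hi ih =>
      set z : Fin d → ℤ := fun k => if k ∈ s then (v k : ℤ) else 0 with hz
      have hstep : (fun k => if k ∈ insert i s then (v k : ℤ) else 0) = z + v i • stdVec i := by
        funext k
        by_cases hk : k = i
        · subst hk
          simp [hz, hi, stdVec]
        · simp [hz, hk, stdVec]
      have h1 := sum_sq_sub_add_nsmul_stdVec_le u S W z i (v i) (by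
        intro x hx j hj
        rw [add_assoc]
        refine hW x hx _ ?_ ?_
        · intro k
          by_cases hk : k = i <;> simp [hz, stdVec, hk] <;> split_ifs <;> positivity
        · intro k
          by_cases hk : k = i
          · subst hk
            simp [hz, hi, stdVec, hj.le]
          · simp only [hz, stdVec, Pi.add_apply, Pi.smul_apply, Pi.single_apply, hk, if_false,
              smul_zero, add_zero]
            split_ifs <;> simp)
      have h2 : ((v i : ℕ) : ℝ) ^ 2 * ∑ y ∈ W, energyDensity u y ≤
          (M : ℝ) ^ 2 * ∑ y ∈ W, energyDensity u y := by
        have := hM i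
        gcongr
      have h3 : 0 ≤ (M : ℝ) ^ 2 * ∑ y ∈ W, energyDensity u y := by positivity
      have h4 : (1 : ℝ) ≤ 4 ^ s.card := one_le_pow₀ (by norm_num)
      rw [hstep, Finset.card_insert_of_notMem hi, pow_succ]
      calc ∑ x ∈ S, (u (x + (z + v i • stdVec i)) - u x) ^ 2
          ≤ ∑ x ∈ S, (2 * (u (x + z) - u x) ^ 2
              + 2 * (u (x + z + v i • stdVec i) - u (x + z)) ^ 2) := by
            refine Finset.sum_le_sum fun x _ => ?_
            rw [← add_assoc]
            nlinarith [sq_nonneg ((u (x + z) - u x)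
              - (u (x + z + v i • stdVec i) - u (x + z)))]
        _ ≤ _ := by
            rw [Finset.sum_add_distrib, ← Finset.mul_sum, ← Finset.mul_sum]
            nlinarith
  have := key Finset.univ
  simp only [Finset.mem_univ, if_true, Finset.card_univ, Fintype.card_fin] at this
  refine this.trans ?_
  have h3 : 0 ≤ (M : ℝ) ^ 2 * ∑ y ∈ W, energyDensity u y := by positivity
  nlinarith

/-! ### Boxes and the multiscale comparison -/

/-- The discrete box `{0, …, L - 1}^d`. -/
def cornerBox (d L : ℕ) : Finset (Fin d → ℕ) := Fintype.piFinset fun _ => Finset.range L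

theorem mem_cornerBox {L : ℕ} {x : Fin d → ℕ} : x ∈ cornerBox d L ↔ ∀ i, x i < L := by
  simp [cornerBox]

theorem card_cornerBox (L : ℕ) : (cornerBox d L).card = L ^ d := by
  simp [cornerBox]

/-- Division with remainder by `L` in each coordinate tiles the large box by `q ^ d` translates of
the small one. -/
theorem sum_cornerBox_mul {L : ℕ} (hL : 0 < L) (q : ℕ) (f : (Fin d → ℕ) → ℝ) :
    ∑ x ∈ cornerBox d (L * q), f x =
      ∑ s ∈ cornerBox d q, ∑ y ∈ cornerBox d L, f (y + L • s) := by
  rw [← Finset.sum_product']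
  refine Finset.sum_nbij' (fun x => (fun i => x i / L, fun i => x i % L))
    (fun p => p.2 + L • p.1) ?_ ?_ ?_ ?_ ?_
  · intro x hx
    simp only [Finset.mem_product, mem_cornerBox] at hx ⊢
    exact ⟨fun i => Nat.div_lt_of_lt_mul (hx i), fun i => Nat.mod_lt _ hL⟩
  · intro p hp
    simp only [Finset.mem_product, mem_cornerBox] at hp ⊢
    intro i
    have h1 := hp.1 i
    have h2 := hp.2 i
    simp only [Pi.add_apply, Pi.smul_apply, smul_eq_mul]
    nlinarith
  · intro x _
    funext i
    simp [Nat.mod_add_div]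
  · intro p hp
    simp only [Finset.mem_product, mem_cornerBox] at hp
    refine Prod.ext (funext fun i => ?_) (funext fun i => ?_)
    · simp [Nat.add_mul_div_left _ _ hL, Nat.div_eq_of_lt (hp.2 i)]
    · simp [Nat.mod_eq_of_lt (hp.2 i)]
  · intro x _
    congr 1
    funext i
    simp [Nat.mod_add_div]

/-- The inclusion `ℕ^d → ℤ^d`. -/
def natVec (x : Fin d → ℕ) : Fin d → ℤ := fun i => x i

/-- Minkowski's inequality without square roots, by Young's inequality with weights tuned to `r` and
`t`. Sharp constants matter: a factor 2 at every scale would destroy the geometric series. -/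
theorem sum_sq_add_le_of_sum_sq_le {ι : Type*} (s : Finset ι) (p q : ι → ℝ) {r t X : ℝ}
    (hr : 0 < r) (ht : 0 < t) (hp : ∑ i ∈ s, p i ^ 2 ≤ r ^ 2 * X)
    (hq : ∑ i ∈ s, q i ^ 2 ≤ t ^ 2 * X) : ∑ i ∈ s, (p i + q i) ^ 2 ≤ (r + t) ^ 2 * X := by
  calc ∑ i ∈ s, (p i + q i) ^ 2
      ≤ ∑ i ∈ s, ((1 + t / r) * p i ^ 2 + (1 + r / t) * q i ^ 2) := by
        refine Finset.sum_le_sum fun i _ => ?_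
        have h : (1 + t / r) * p i ^ 2 + (1 + r / t) * q i ^ 2 - (p i + q i) ^ 2
            = (t * p i - r * q i) ^ 2 / (r * t) := by
          field_simp
          ring
        have : 0 ≤ (t * p i - r * q i) ^ 2 / (r * t) := by positivity
        linarith
    _ ≤ (1 + t / r) * (r ^ 2 * X) + (1 + r / t) * (t ^ 2 * X) := by
        rw [Finset.sum_add_distrib, ← Finset.mul_sum, ← Finset.mul_sum]
        gcongr
    _ = (r + t) ^ 2 * X := by
        field_simp
        ring

/-- The translation estimate on a box with corner `a`. -/
theorem sum_cornerBox_sq_sub_translate_le (u : (Fin d → ℤ) → ℝ) (W : Finset (Fin d → ℤ))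
    (a : Fin d → ℤ) (L M : ℕ) (v : Fin d → ℕ) (hv : ∀ i, v i ≤ M)
    (hW : ∀ w : Fin d → ℕ, (∀ i, w i < L + v i) → a + natVec w ∈ W) :
    ∑ y ∈ cornerBox d L, (u (a + natVec (y + v)) - u (a + natVec y)) ^ 2 ≤
      4 ^ d * (M : ℝ) ^ 2 * ∑ y ∈ W, energyDensity u y := by
  have hinj : Set.InjOn (fun y => a + natVec y) (cornerBox d L : Set (Fin d → ℕ)) := by
    intro x _ y _ h
    have h' : natVec x = natVec y := by simpa using h
    funext i
    exact Int.ofNat_inj.1 (congrFun h' i)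
  have h := sum_sq_sub_translate_le u ((cornerBox d L).image fun y => a + natVec y) W v M hv (by
    intro x hx w hw0 hwv
    obtain ⟨y, hy, rfl⟩ := Finset.mem_image.1 hx
    rw [mem_cornerBox] at hy
    have : a + natVec y + w = a + natVec (fun i => y i + (w i).toNat) := by
      funext i
      have : 0 ≤ w i := hw0 i
      simp only [natVec, Pi.add_apply]
      push_cast
      rw [Int.toNat_of_nonneg this]
      ring
    rw [this]
    refine hW _ fun i => ?_
    have h1 : 0 ≤ w i := hw0 i
    have h2 := hwv i
    have h3 := hy i
    omega)
  rw [Finset.sum_image hinj] at h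
  refine le_of_eq_of_le (Finset.sum_congr rfl fun y _ => ?_) h
  have : a + natVec (y + v) = a + natVec y + fun i => (v i : ℤ) := by
    funext i
    simp [natVec, add_assoc]
  rw [this]

/-- In dimension at least three, the square mean over a box of the deviation from the value at its
corner is bounded by the energy, uniformly in the size of the box. -/
theorem sum_cornerBox_sq_sub_corner_le (hd : 2 < d) (u : (Fin d → ℤ) → ℝ)
    (W : Finset (Fin d → ℤ)) (a : Fin d → ℤ) (K : ℕ)
    (hW : ∀ w : Fin d → ℕ, (∀ i, w i < 4 ^ K) → a + natVec w ∈ W) :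
    ∑ x ∈ cornerBox d (4 ^ K), (u (a + natVec x) - u a) ^ 2 ≤
      (9 * 2 ^ d) ^ 2 * ((((4 ^ K : ℕ) : ℝ)) ^ d * ∑ y ∈ W, energyDensity u y) := by
  have hE : 0 ≤ ∑ y ∈ W, energyDensity u y := Finset.sum_nonneg fun y _ => energyDensity_nonneg u y
  set E := ∑ y ∈ W, energyDensity u y with hEdef
  -- The factor `3 - 2 (1/2) ^ k` grows by exactly `(1/2) ^ k` at each scale. It starts at 1 rather
  -- than 0 because the Minkowski step needs `0 < r`.
  have key : ∀ k ≤ K, ∑ x ∈ cornerBox d (4 ^ k), (u (a + natVec x) - u a) ^ 2 ≤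
      (3 * 2 ^ d * (3 - 2 * (1 / 2) ^ k)) ^ 2 * ((((4 ^ k : ℕ) : ℝ)) ^ d * E) := by
    intro k
    induction k with
    | zero =>
      intro _
      have h0 : ∑ x ∈ cornerBox d (4 ^ 0), (u (a + natVec x) - u a) ^ 2 = 0 := by
        refine Finset.sum_eq_zero fun x hx => ?_
        have : a + natVec x = a := by
          funext i
          have := mem_cornerBox.1 hx i
          simp only [natVec, Pi.add_apply]
          omega
        simp [this]
      rw [h0]
      positivity
    | succ k ih =>
      intro hk
      have hpk : ((1 : ℝ) / 2) ^ k ≤ 1 := pow_le_one₀ (by norm_num) (by norm_num)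
      have hpk0 : (0 : ℝ) < (1 / 2) ^ k := by positivity
      have hle : 4 ^ k * 4 ≤ 4 ^ K := by
        rw [← pow_succ]
        exact Nat.pow_le_pow_right (by norm_num) hk
      have hs : ∀ s ∈ cornerBox d 4, ∑ y ∈ cornerBox d (4 ^ k),
          (u (a + natVec (y + 4 ^ k • s)) - u a) ^ 2 ≤
          (3 * 2 ^ d * (3 - 2 * (1 / 2) ^ k) + 3 * 2 ^ d * (1 / 2) ^ k) ^ 2
            * ((((4 ^ k : ℕ) : ℝ)) ^ d * E) := by
        intro s hs
        rw [mem_cornerBox] at hs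
        have h1 := sum_cornerBox_sq_sub_translate_le u W a (4 ^ k) (4 ^ k * 3) (4 ^ k • s)
          (fun i => by
            have := hs i
            simp only [Pi.smul_apply, smul_eq_mul]
            gcongr
            omega)
          (fun w hw => hW w fun i => by
            have h1 := hw i
            have h2 := hs i
            simp only [Pi.smul_apply, smul_eq_mul] at h1
            have : 4 ^ k * s i ≤ 4 ^ k * 3 := by gcongr; omega
            omega)
        have h2 : (4 : ℝ) ^ d * ((4 ^ k * 3 : ℕ) : ℝ) ^ 2 * E ≤
            (3 * 2 ^ d * (1 / 2) ^ k) ^ 2 * ((((4 ^ k : ℕ) : ℝ)) ^ d * E) := by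
          -- The use of `2 < d`: three powers of the side length beat the two lost by translation,
          -- leaving the decay `(1/2) ^ k` after a square root.
          have h3 : (((4 ^ k : ℕ) : ℝ)) ^ 3 ≤ (((4 ^ k : ℕ) : ℝ)) ^ d := by
            refine pow_le_pow_right₀ ?_ hd
            exact_mod_cast Nat.one_le_pow _ _ (by norm_num)
          have h4 : (4 : ℝ) ^ d * ((4 ^ k * 3 : ℕ) : ℝ) ^ 2 * E =
              (3 * 2 ^ d * (1 / 2) ^ k) ^ 2 * ((((4 ^ k : ℕ) : ℝ)) ^ 3 * E) := by
            have h5 : (4 : ℝ) ^ d = (2 ^ d) ^ 2 := by rw [← pow_mul, mul_comm, pow_mul]; norm_num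
            have h6 : (((1 : ℝ) / 2) ^ k) ^ 2 * 4 ^ k = 1 := by
              rw [← pow_mul, mul_comm k, pow_mul, ← mul_pow]; norm_num
            push_cast
            rw [h5]
            linear_combination (-9 * (2 ^ d) ^ 2 * (4 ^ k) ^ 2 * E) * h6
          rw [h4]
          gcongr
        refine le_of_eq_of_le (Finset.sum_congr rfl fun y _ => ?_)
          (sum_sq_add_le_of_sum_sq_le _ (fun y => u (a + natVec y) - u a)
            (fun y => u (a + natVec (y + 4 ^ k • s)) - u (a + natVec y))
            (mul_pos (by positivity) (by linarith)) (by positivity) (ih (by omega)) (h1.trans h2))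
        ring
      rw [pow_succ, sum_cornerBox_mul (by positivity)]
      refine (Finset.sum_le_sum hs).trans (le_of_eq ?_)
      rw [Finset.sum_const, card_cornerBox, nsmul_eq_mul]
      push_cast
      rw [mul_pow, pow_succ]
      ring
  refine (key K le_rfl).trans ?_
  have h1 : ((1 : ℝ) / 2) ^ K ≤ 1 := pow_le_one₀ (by norm_num) (by norm_num)
  have h2 : (0 : ℝ) < (1 / 2) ^ K := by positivity
  have h3 : 3 * 2 ^ d * (3 - 2 * (1 / 2) ^ K) ≤ (9 : ℝ) * 2 ^ d := by
    have : (0 : ℝ) < 2 ^ d := by positivity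
    nlinarith
  have h4 : 0 ≤ 3 * (2 : ℝ) ^ d * (3 - 2 * (1 / 2) ^ K) :=
    mul_nonneg (by positivity) (by linarith)
  gcongr

/-- In dimension at least three, two values of `u` at distance at most `L = 4 ^ K` differ by at
most a constant times the square root of the energy nearby. -/
theorem sq_sub_le_energy (hd : 2 < d) (u : (Fin d → ℤ) → ℝ) (a b : Fin d → ℤ) (K : ℕ)
    (hab : ∀ i, |a i - b i| ≤ (4 : ℤ) ^ K) :
    (u a - u b) ^ 2 ≤ 656 * 4 ^ d *
      ∑ y ∈ Finset.Icc (a - fun _ => 2 * 4 ^ K) (a + fun _ => 2 * 4 ^ K), energyDensity u y := by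
  set W := Finset.Icc (a - fun _ => 2 * 4 ^ K) (a + fun _ => 2 * 4 ^ K) with hWdef
  have hE : 0 ≤ ∑ y ∈ W, energyDensity u y := Finset.sum_nonneg fun y _ => energyDensity_nonneg u y
  set E := ∑ y ∈ W, energyDensity u y with hEdef
  set L : ℕ := 4 ^ K with hL
  have hLZ : (4 : ℤ) ^ K = (L : ℤ) := by simp [hL]
  have hL1 : (1 : ℝ) ≤ (L : ℝ) := by
    exact_mod_cast Nat.one_le_pow K 4 (by norm_num)
  have hmem : ∀ x : Fin d → ℤ, (∀ i, a i - 2 * L ≤ x i ∧ x i ≤ a i + 2 * L) → x ∈ W := by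
    intro x hx
    rw [hWdef, Finset.mem_Icc, hLZ]
    exact ⟨fun i => (hx i).1, fun i => (hx i).2⟩
  have hab' : ∀ i, a i - b i ≤ L ∧ b i - a i ≤ L := by
    intro i
    have := abs_le.1 (hab i)
    rw [hLZ] at this
    constructor <;> linarith [this.1, this.2]
  have ha := sum_cornerBox_sq_sub_corner_le hd u W a K fun w hw => hmem _ fun i => by
    have := hw i
    simp only [natVec, Pi.add_apply]
    omega
  have hb := sum_cornerBox_sq_sub_corner_le hd u W b K fun w hw => hmem _ fun i => by
    have := hw i
    have := hab' i
    simp only [natVec, Pi.add_apply]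
    omega
  -- The translation estimate only allows nonnegative shifts, so the boxes at `a` and `b` are both
  -- compared with the box at `a ⊓ b`.
  have htrans : ∀ e : Fin d → ℤ, (∀ i, a i ⊓ b i ≤ e i ∧ e i ≤ a i ⊔ b i) →
      ∑ y ∈ cornerBox d L, (u (e + natVec y) - u (a ⊓ b + natVec y)) ^ 2 ≤
        4 ^ d * (L : ℝ) ^ 2 * E := by
    intro e he
    have h := sum_cornerBox_sq_sub_translate_le u W (a ⊓ b) L L
      (fun i => (e i - (a i ⊓ b i)).toNat)
      (fun i => by
        have := hab' i
        have := he i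
        omega)
      (fun w hw => hmem _ fun i => by
        have := hab' i
        have := he i
        have := hw i
        simp only [natVec, Pi.add_apply, Pi.inf_apply]
        omega)
    refine le_of_eq_of_le (Finset.sum_congr rfl fun y _ => ?_) h
    have : a ⊓ b + natVec (y + fun i => (e i - (a i ⊓ b i)).toNat) = e + natVec y := by
      funext i
      have := he i
      simp only [natVec, Pi.add_apply, Pi.inf_apply]
      omega
    rw [this]
  have hca := htrans a fun i => ⟨inf_le_left, le_sup_left⟩
  have hcb := htrans b fun i => ⟨inf_le_right, le_sup_right⟩
  have hL2 : 4 ^ d * (L : ℝ) ^ 2 * E ≤ 4 ^ d * (L : ℝ) ^ d * E := by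
    gcongr
  have h4 : (9 * (2 : ℝ) ^ d) ^ 2 = 81 * 4 ^ d := by
    rw [mul_pow, ← pow_mul, mul_comm d, pow_mul]; norm_num
  rw [h4] at ha hb
  -- The chain from `u a` to `u b` has four links, so Cauchy–Schwarz gives the factor 4 and `656 = 4
  -- * (81 + 1 + 1 + 81)`.
  have hsum : (L : ℝ) ^ d * (u a - u b) ^ 2 ≤ ∑ y ∈ cornerBox d L,
      4 * ((u (a + natVec y) - u a) ^ 2 + (u (a + natVec y) - u (a ⊓ b + natVec y)) ^ 2
        + (u (b + natVec y) - u (a ⊓ b + natVec y)) ^ 2 + (u (b + natVec y) - u b) ^ 2) := by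
    have : (L : ℝ) ^ d * (u a - u b) ^ 2 = ∑ _y ∈ cornerBox d L, (u a - u b) ^ 2 := by
      rw [Finset.sum_const, card_cornerBox, nsmul_eq_mul]
      push_cast
      rfl
    rw [this]
    refine Finset.sum_le_sum fun y _ => ?_
    generalize u (a + natVec y) = p
    generalize u (b + natVec y) = q
    generalize u (a ⊓ b + natVec y) = r
    nlinarith [sq_nonneg ((p - u a) + (p - r)), sq_nonneg ((p - u a) - (q - r)),
      sq_nonneg ((p - u a) + (q - u b)), sq_nonneg ((p - r) + (q - r)),
      sq_nonneg ((p - r) - (q - u b)), sq_nonneg ((q - r) + (q - u b))]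
  rw [← Finset.mul_sum, Finset.sum_add_distrib, Finset.sum_add_distrib,
    Finset.sum_add_distrib] at hsum
  refine le_of_mul_le_mul_left (a := (L : ℝ) ^ d) ?_ (by positivity)
  nlinarith

/-! ### Lattice sums and the quadratic form -/

theorem summable_comp_add {f : (Fin d → ℤ) → ℝ} (hf : Summable f) (e : Fin d → ℤ) :
    Summable fun x => f (x + e) :=
  (Equiv.addRight e).summable_iff.2 hf

theorem tsum_comp_add (f : (Fin d → ℤ) → ℝ) (e : Fin d → ℤ) : ∑' x, f (x + e) = ∑' x, f x :=
  (Equiv.addRight e).tsum_eq f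

/-- A pointwise bound by local sums of a density gives a global bound. -/
theorem tsum_le_of_le_local_sum {f g : (Fin d → ℤ) → ℝ} (hf : Summable f) (hg : Summable g)
    (N : Finset (Fin d → ℤ)) (c : ℝ) (h : ∀ a, f a ≤ c * ∑ y ∈ N, g (a + y)) :
    ∑' a, f a ≤ c * (N.card * ∑' a, g a) := by
  have hs : ∀ y ∈ N, Summable fun a => g (a + y) := fun y _ => summable_comp_add hg y
  calc ∑' a, f a ≤ ∑' a, c * ∑ y ∈ N, g (a + y) :=
        hf.tsum_le_tsum h ((summable_sum hs).mul_left c)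
    _ = c * (N.card * ∑' a, g a) := by
        rw [tsum_mul_left, Summable.tsum_finsetSum hs]
        simp only [tsum_comp_add, Finset.sum_const, nsmul_eq_mul]

theorem summable_mul_of_finite_support {u : (Fin d → ℤ) → ℝ} (hu : u.support.Finite)
    (f : (Fin d → ℤ) → ℝ) : Summable fun x => f x * u x :=
  summable_of_hasFiniteSupport (hu.subset fun _ hx => right_ne_zero_of_mul hx)

/-- Summation by parts on the lattice. -/
theorem hasSum_energyDensity {u : (Fin d → ℤ) → ℝ} (hu : u.support.Finite) :
    HasSum (energyDensity u) (∑' x, -laplacian u x * u x) := by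
  have hF : ∀ i : Fin d, Summable fun x => (u x - u (x - stdVec i)) * u x := fun i =>
    summable_mul_of_finite_support hu _
  -- The energy density and `-laplacian u * u` differ pointwise by these discrete divergences, whose
  -- sums vanish by translation invariance.
  have hdiff : ∀ i : Fin d, HasSum (fun x => (u (x + stdVec i) - u x) * u (x + stdVec i)
      - (u x - u (x - stdVec i)) * u x) 0 := by
    intro i
    have h1 := summable_comp_add (hF i) (stdVec i)
    have h2 := tsum_comp_add (fun x => (u x - u (x - stdVec i)) * u x) (stdVec i)
    simp only [add_sub_cancel_right] at h1 h2
    have := h1.hasSum.sub (hF i).hasSum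
    rwa [h2, sub_self] at this
  have h := (summable_mul_of_finite_support hu fun x => -laplacian u x).hasSum.add
    (hasSum_sum fun i (_ : i ∈ Finset.univ) => hdiff i)
  rw [Finset.sum_const_zero, add_zero] at h
  refine h.congr_fun ?_
  intro x
  have hc : (2 * (d : ℝ)) * u x = ∑ _i : Fin d, 2 * u x := by
    rw [Finset.sum_const, Finset.card_univ, Fintype.card_fin, nsmul_eq_mul]
    ring
  have hl : -laplacian u x * u x
      = ∑ i, (2 * u x - (u (x + stdVec i) + u (x - stdVec i))) * u x := by
    rw [← Finset.sum_mul, Finset.sum_sub_distrib, ← hc, laplacian]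
    ring
  rw [hl, energyDensity, ← Finset.sum_add_distrib]
  exact Finset.sum_congr rfl fun i _ => by ring

theorem extendZero_coe {n : ℕ} (w : CubeL2 d n) (a : cube d n) : extendZero w a = w a := by
  simp [extendZero]

theorem extendZero_of_notMem {n : ℕ} (w : CubeL2 d n) {a : Fin d → ℤ} (ha : a ∉ cube d n) :
    extendZero w a = 0 := by
  simp [extendZero, ha]

theorem finite_support_extendZero {n : ℕ} (w : CubeL2 d n) :
    (extendZero w).support.Finite :=
  (cube d n).finite_toSet.subset fun _ ha => by
    by_contra h
    exact ha (extendZero_of_notMem w h)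

theorem tsum_mul_extendZero {n : ℕ} (w : CubeL2 d n) (f : (Fin d → ℤ) → ℝ) :
    ∑' x, f x * extendZero w x = ∑ a : cube d n, f a * w a := by
  rw [tsum_eq_sum (s := cube d n) fun x hx => by rw [extendZero_of_notMem w hx, mul_zero],
    ← Finset.sum_coe_sort]
  exact Finset.sum_congr rfl fun a _ => by rw [extendZero_coe]

/-- The quadratic form of `-Δ + V` is the sum of its density over the lattice. -/
theorem hasSum_quadraticForm {n : ℕ} (V : cube d n → ℝ) (w : CubeL2 d n) :
    HasSum (fun x => energyDensity (extendZero w) x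
      + extendZero (WithLp.toLp 2 V) x * extendZero w x ^ 2)
      (∑ a : cube d n, dirichletOp V w a * w a) := by
  have hu := finite_support_extendZero w
  have h1 := hasSum_energyDensity hu
  have h2 := (summable_mul_of_finite_support hu
    fun x => extendZero (WithLp.toLp 2 V) x * extendZero w x).hasSum
  rw [tsum_mul_extendZero] at h1 h2
  convert h1.add h2 using 1
  · funext x
    ring
  · rw [← Finset.sum_add_distrib]
    refine Finset.sum_congr rfl fun a _ => ?_
    simp only [extendZero_coe, dirichletOp, LinearMap.coe_mk, AddHom.coe_mk]
    ring

/-! ### The Poincaré inequality -/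

theorem abs_apply_le_euclNorm (a : Fin d → ℤ) (i : Fin d) : |(a i : ℝ)| ≤ euclNorm a := by
  rw [euclNorm, ← Real.sqrt_sq_eq_abs]
  exact Real.sqrt_le_sqrt (Finset.single_le_sum (f := fun k => (a k : ℝ) ^ 2)
    (fun _ _ => sq_nonneg _) (Finset.mem_univ i))

/-- If every point of the cube is within `4 ^ K` of a point where `V = 1`, the square of a function
at a point is controlled by the density of the quadratic form nearby. -/
theorem sq_extendZero_le_local_sum (hd : 2 < d) {n : ℕ} {V : cube d n → ℝ}
    (hV : ∀ a, V a ∈ Set.Icc (0 : ℝ) 1) (K : ℕ)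
    (hb : ∀ a : cube d n, ∃ b : cube d n,
      V b = 1 ∧ ∀ i, |(a : Fin d → ℤ) i - (b : Fin d → ℤ) i| ≤ 4 ^ K)
    (w : CubeL2 d n) (a : Fin d → ℤ) :
    extendZero w a ^ 2 ≤ 1312 * 4 ^ d *
      ∑ y ∈ Finset.Icc (-fun _ => 2 * 4 ^ K) (fun _ => 2 * 4 ^ K),
        (energyDensity (extendZero w) (a + y)
          + extendZero (WithLp.toLp 2 V) (a + y) * extendZero w (a + y) ^ 2) := by
  have hV0 : ∀ x, 0 ≤ extendZero (WithLp.toLp 2 V) x * extendZero w x ^ 2 := by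
    intro x
    refine mul_nonneg ?_ (sq_nonneg _)
    unfold extendZero
    split_ifs with h
    · exact (hV ⟨x, h⟩).1
    · exact le_rfl
  have hW : ∀ g : (Fin d → ℤ) → ℝ, ∑ y ∈ Finset.Icc (-fun _ => 2 * 4 ^ K) (fun _ => 2 * 4 ^ K),
      g (a + y) = ∑ x ∈ Finset.Icc (a - fun _ => 2 * 4 ^ K) (a + fun _ => 2 * 4 ^ K), g x := by
    intro g
    rw [sub_eq_add_neg, ← Finset.map_add_left_Icc, Finset.sum_map]
    rfl
  rw [hW fun x => energyDensity (extendZero w) x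
    + extendZero (WithLp.toLp 2 V) x * extendZero w x ^ 2, Finset.sum_add_distrib]
  set W := Finset.Icc (a - fun _ => 2 * 4 ^ K) (a + fun _ => 2 * 4 ^ K) with hWdef
  have hE : 0 ≤ ∑ x ∈ W, energyDensity (extendZero w) x :=
    Finset.sum_nonneg fun y _ => energyDensity_nonneg _ y
  have hP : 0 ≤ ∑ x ∈ W, extendZero (WithLp.toLp 2 V) x * extendZero w x ^ 2 :=
    Finset.sum_nonneg fun y _ => hV0 y
  by_cases ha : a ∈ cube d n
  · obtain ⟨b, hVb, hab⟩ := hb ⟨a, ha⟩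
    have hbW : (b : Fin d → ℤ) ∈ W := by
      have h4 : (0 : ℤ) < 4 ^ K := by positivity
      rw [hWdef, Finset.mem_Icc]
      constructor <;> intro i <;> have := abs_le.1 (hab i) <;>
        simp only [Pi.sub_apply, Pi.add_apply] at this ⊢ <;> linarith [this.1, this.2]
    have h1 := sq_sub_le_energy hd (extendZero w) a b K hab
    have h2 : extendZero w b ^ 2 ≤
        ∑ x ∈ W, extendZero (WithLp.toLp 2 V) x * extendZero w x ^ 2 := by
      refine le_of_eq_of_le ?_ (Finset.single_le_sum (fun x _ => hV0 x) hbW)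
      rw [extendZero_coe (WithLp.toLp 2 V)]
      simp [hVb]
    have h4 : (1 : ℝ) ≤ 4 ^ d := one_le_pow₀ (by norm_num)
    have h5 := mul_le_mul_of_nonneg_right h4 hP
    -- The hint is `p² ≤ 2 (p - q)² + 2 q²`, whence `1312 = 2 * 656`.
    nlinarith [sq_nonneg (extendZero w a - 2 * extendZero w b)]
  · rw [extendZero_of_notMem w ha, zero_pow two_ne_zero]
    exact mul_nonneg (by positivity) (add_nonneg hE hP)

/-- A Poincaré inequality for functions on the cube. -/
theorem sum_sq_le_quadraticForm (hd : 2 < d) {n : ℕ} {V : cube d n → ℝ}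
    (hV : ∀ a, V a ∈ Set.Icc (0 : ℝ) 1) (K : ℕ)
    (hb : ∀ a : cube d n, ∃ b : cube d n,
      V b = 1 ∧ ∀ i, |(a : Fin d → ℤ) i - (b : Fin d → ℤ) i| ≤ 4 ^ K)
    (w : CubeL2 d n) :
    ∑ a, w a * w a ≤ 1312 * 4 ^ d *
      ((4 * 4 ^ K + 1) ^ d * ∑ a : cube d n, dirichletOp V w a * w a) := by
  have hq := hasSum_quadraticForm V w
  have h := tsum_le_of_le_local_sum
    (summable_mul_of_finite_support (finite_support_extendZero w) (extendZero w)) hq.summable _ _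
    fun a => (sq _).symm.trans_le (sq_extendZero_le_local_sum hd hV K hb w a)
  rw [tsum_mul_extendZero, hq.tsum_eq] at h
  simp only [extendZero_coe] at h
  refine h.trans (le_of_eq ?_)
  have hcard : (Finset.Icc (-fun _ : Fin d => (2 * 4 ^ K : ℤ)) (fun _ => 2 * 4 ^ K)).card
      = (4 * 4 ^ K + 1) ^ d := by
    have h1 : (2 * 4 ^ K + 1 + 2 * 4 ^ K : ℤ).toNat = 4 * 4 ^ K + 1 := by
      have : (2 * 4 ^ K + 1 + 2 * 4 ^ K : ℤ) = ((4 * 4 ^ K + 1 : ℕ) : ℤ) := by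
        push_cast
        ring
      rw [this, Int.toNat_natCast]
    simp [Pi.card_Icc, Int.card_Icc, h1]
  rw [hcard]
  push_cast
  rfl

end LatticeSchrodinger

/-! ### The eigenvalue bound -/

theorem theoremB1 (d : ℕ) (hd : 2 < d) :
    ∃ C : ℝ, 0 < C ∧ ∃ R₀ : ℝ, 0 < R₀ ∧
      ∀ (n : ℕ) (V : LatticeSchrodinger.cube d n → ℝ) (R : ℝ),
        (∀ a, V a ∈ Set.Icc (0 : ℝ) 1) →
        R₀ ≤ R →
        (∀ a : LatticeSchrodinger.cube d n, ∃ b : LatticeSchrodinger.cube d n,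
          V b = 1 ∧ LatticeSchrodinger.euclNorm ((a : Fin d → ℤ) - (b : Fin d → ℤ)) < R) →
        C * R ^ (-(d : ℤ)) ≤ LatticeSchrodinger.principalEigenvalue V := by
  -- `80 = 4 * 20`: with `4 ^ k ≤ R < 4 ^ (k + 1)` and `1 ≤ R`, the neighbourhood has side `16 * 4 ^
  -- k + 1 ≤ 20 * R`.
  refine ⟨(1312 * 80 ^ d)⁻¹, by positivity, 1, one_pos, ?_⟩
  intro n V R hV hR hb
  obtain ⟨k, hk1, hk2⟩ := exists_nat_pow_near hR (by norm_num : (1 : ℝ) < 4)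
  have hb' : ∀ a : LatticeSchrodinger.cube d n, ∃ b : LatticeSchrodinger.cube d n,
      V b = 1 ∧ ∀ i, |(a : Fin d → ℤ) i - (b : Fin d → ℤ) i| ≤ 4 ^ (k + 1) := by
    intro a
    obtain ⟨b, hVb, hab⟩ := hb a
    refine ⟨b, hVb, fun i => ?_⟩
    have := (LatticeSchrodinger.abs_apply_le_euclNorm ((a : Fin d → ℤ) - (b : Fin d → ℤ)) i).trans
      (hab.le.trans hk2.le)
    exact_mod_cast this
  obtain ⟨w, hw⟩ :=
    (LatticeSchrodinger.principalEigenvalue_isLeast V).1.exists_hasEigenvector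
  set μ := LatticeSchrodinger.principalEigenvalue V with hμ
  have h := LatticeSchrodinger.sum_sq_le_quadraticForm hd hV (k + 1) hb' w
  have hS : 0 < ∑ a, w a * w a := by
    have h1 : ∑ a, w a * w a = ‖w‖ ^ 2 := by
      rw [EuclideanSpace.real_norm_sq_eq]
      exact Finset.sum_congr rfl fun a _ => (sq _).symm
    rw [h1]
    have := norm_pos_iff.2 hw.2
    positivity
  rw [hw.apply_eq_smul] at h
  simp only [PiLp.smul_apply, smul_eq_mul, mul_assoc] at h
  rw [← Finset.mul_sum] at h
  set S := ∑ a, w a * w a with hSdef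
  have h1 : 1 ≤ 1312 * 4 ^ d * (4 * 4 ^ (k + 1) + 1) ^ d * μ := by
    refine le_of_mul_le_mul_right ?_ hS
    linarith
  have hpos : 0 < μ := by
    by_contra hneg
    have : 1312 * 4 ^ d * (4 * 4 ^ (k + 1) + 1) ^ d * μ ≤ 0 :=
      mul_nonpos_of_nonneg_of_nonpos (by positivity) (not_lt.1 hneg)
    linarith
  have h2 : (4 * 4 ^ (k + 1) + 1 : ℝ) ≤ 20 * R := by
    rw [pow_succ]
    linarith
  have h3 : 1 ≤ 1312 * 80 ^ d * R ^ d * μ := by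
    calc (1 : ℝ) ≤ 1312 * 4 ^ d * (4 * 4 ^ (k + 1) + 1) ^ d * μ := h1
      _ ≤ 1312 * 4 ^ d * (20 * R) ^ d * μ := by gcongr
      _ = 1312 * 80 ^ d * R ^ d * μ := by
        rw [mul_assoc 1312, ← mul_pow, mul_assoc 1312 (80 ^ d), ← mul_pow]
        ring_nf
  have hR0 : 0 < R := one_pos.trans_le hR
  rw [zpow_neg, zpow_natCast, ← mul_inv, inv_le_iff_one_le_mul₀' (by positivity)]
  exact h3
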